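/- **Setting.** Write $[m]=\{0,\dots,m-1\}$ and let $U$ be a finite totally ordered universe. Let $c\ge 1$, $d\ge 2$, $\ell\ge1$, $m\ge 1$. Let $\mathcal F$ be any nonempty set of functions $U\to[\ell]$ that is 2-universal ($\Pr_{g\in\mathcal F}(g(x)=g(y))\le 2/\ell$ for all $x\ne y$), and let $\mathcal H$ be any nonempty set of functions $U\to[m]$ that is 2-wise independent ($\Pr_{f\in\mathcal H}(f(x)=a\wedge f(y)=b)=1/m^2$ for all $x\neq y$ and $a,b\in[m]$). The class $\mathcal Z=\mathcal Z^{c,d}_{\ell,m}(\mathcal F,\mathcal H)$ consists of all $\vec h=(h_1,\dots,h_d)$ given by $f_1,\dots,f_d\in\mathcal H$, $g_1,\dots,g_c\in\mathcal F$ and arbitrary tables $z^{(1)},\dots,z^{(d)}$ with entries $z^{(i)}[j,k]\in[m]$ ($1\le j\le c$, $k\in[\ell]$), via $$h_i(x)=\Bigl(f_i(x)+\sum_{j=1}^{c} z^{(i)}[j,g_j(x)]\Bigr)\bmod m .$$ $\Pr$ refers to the uniform choice of $(f_1,\dots,f_d,g_1,\dots,g_c,z^{(1)},\dots,z^{(d)})$.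 For $T\subseteq U$, $\mathrm{bad}_T$ is the event $|T|-\max_j|g_j(T)|>1$. $\mathcal G^d_{m,n}$ is the set of $d$-partite multi-hypergraphs whose vertex set is $d$ disjoint copies of $[m]$, in which every edge has at least two vertices and at most one in each copy, and whose edges carry distinct labels from $\{1,\dots,n\}$. For $S=\{x_1<\dots<x_n\}\subseteq U$, $G(S,\vec h)$ is the hypergraph with edges $(h_1(x_i),\dots,h_d(x_i))$ labelled $i$, $1\le i\le n$. A hypergraph $G$ is a subgraph of $G(S,\vec h)$ if each edge of $G$ is a subset of the edge of $G(S,\vec h)$ with the same label. For $G\in \mathcal G^d_{m,n}$ let $T(G)\subseteq S$ be the set of keys $x_i$ such that $G$ has an edge labelled $i$. For $\mathsf A\subseteq\mathcal G^d_{m,n}$ let $$B^{\mathsf A}_S=\bigcup_{G\in\mathsf A}\bigl(\{G\text{ is a subgraph of }G(S,\vec h)\}\cap \mathrm{bad}_{T(G)}\bigr).$$ Below, $d\mid n$, $m=n/d$, $\log=\log_2$, and isolated vertices are always disregarded. $\mathsf C_{small}(K,d)$ is the set of connected $G=(V,E)\in\mathcal G^d_{n/d,n}$ with $|E|\le K\log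 n$. $\mathrm{bi}(G)$ denotes the bipartite incidence graph of $G$ (edges of $G$ are "job vertices", vertices of $G$ are "machine vertices"). A $(k,t)$-multicycle is a connected graph with cyclomatic number $k$ (edges minus vertices plus one) having a root $s$ and a shortest path tree rooted at $s$ of depth at most $t$ in which each leaf other than $s$ is incident to an edge of the graph not in the tree. The regular witness tree with $r$ job levels has a machine vertex as root; each machine vertex has $\tau$ job children as long as fewer than $r$ job levels lie above it (otherwise it is a leaf), and each job vertex has $d-1$ machine children; so it has $j_r=\sum_{i=0}^{r-1}\tau(\tau(d-1))^i$ job vertices. $\mathsf{MCWT}_{k,t,r}$ is the set of $G\in\mathcal G^d_{n/d,n}$ for which $\mathrm{bi}(G)$ is a $(k,t)$-multicycle or the regular witness tree with $r$ job levels. **Lemma.** Let $K>0$ be a real number and let $c\ge1$, $d\ge2$ be integers. There is a constant $C>0$, depending only on $K,c,d$, such that for all integers $n\ge1$ with $d\mid n$, all $\ell\ge1$, all $U$, $\mathcal F$, $\mathcal H$ as above with $m=n/d$, and all $S\subseteq U$ with $|S|=n$: 1. $\displaystyle \Pr\bigl(B^{\mathsf C_{small}(K,d)}_S\bigr)\le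 C\cdot\frac{n^{K(d+1)\log d+2}}{\ell^{c}}$; 2. for all integers $\tau,r\ge 0$ and $k,t\ge1$ with $2kt+1\le K\log n$ and $j_r\le K\log n$, $$\Pr\bigl(B^{\mathsf{MCWT}_{k,t,r}}_S\bigr)\le \Pr\bigl(B^{\mathsf C_{small}(K,d)}_S\bigr).$$ -/

import Mathlib

universe u

namespace HashGraph

/-! Uniform probability, hash classes. -/

open Classical in
/-- Probability of the event `P` when `ω` is drawn uniformly at random from the finite set `A`. -/
noncomputable def uniformProb {Ω : Type*} (A : Finset Ω) (P : Ω → Prop) : ℝ :=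
  ((A.filter P).card : ℝ) / (A.card : ℝ)

/-- A (nonempty) hash class `F` of functions `U → [ℓ]` is `a`-universal. -/
def IsUniversal {U : Type*} {ℓ : ℕ} (a : ℝ) (F : Finset (U → Fin ℓ)) : Prop :=
  F.Nonempty ∧ ∀ x y : U, x ≠ y → uniformProb F (fun h => h x = h y) ≤ a / (ℓ : ℝ)

/-- A (nonempty) hash class `H` of functions `U → [m]` is `κ`-wise independent. -/
def IsWiseIndependent {U : Type*} {m : ℕ} (κ : ℕ) (H : Finset (U → Fin m)) : Prop :=
  H.Nonempty ∧ ∀ (x : Fin κ → U), Function.Injective x → ∀ j : Fin κ → Fin m,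
    uniformProb H (fun h => ∀ i, h (x i) = j i) = 1 / (m : ℝ) ^ κ

/-- The components `(f, g, z)` of a sequence of `d` hash functions: `f₁,…,f_d : U → [m]`,
`g₁,…,g_c : U → [ℓ]`, and the tables `z⁽¹⁾,…,z⁽ᵈ⁾` with entries `z⁽ⁱ⁾[j, k] ∈ [m]`. -/
abbrev HashSeq (U : Type*) (c d ℓ m : ℕ) : Type _ :=
  (Fin d → U → Fin m) × (Fin c → U → Fin ℓ) × (Fin d → Fin c → Fin ℓ → Fin m)

/-- `h_i(x) = (f_i(x) + ∑_j z⁽ⁱ⁾[j, g_j(x)]) mod m`. -/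
def HashSeq.eval {U : Type*} {c d ℓ m : ℕ} (ω : HashSeq U c d ℓ m) (i : Fin d) (x : U) : Fin m :=
  ⟨((ω.1 i x : ℕ) + ∑ j : Fin c, (ω.2.2 i j (ω.2.1 j x) : ℕ)) % m,
    Nat.mod_lt _ (ω.1 i x).pos⟩

/-- The class `𝒵^{c,d}_{ℓ,m}(F, H)`: all `f_i` from `H`, all `g_j` from `F`, arbitrary tables. -/
def hashClassZ {U : Type*} (c d : ℕ) {ℓ m : ℕ} (F : Finset (U → Fin ℓ)) (H : Finset (U → Fin m)) :
    Finset (HashSeq U c d ℓ m) :=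
  (Fintype.piFinset fun _ => H) ×ˢ (Fintype.piFinset fun _ => F) ×ˢ Finset.univ

/-- The deficiency `d_T = |T| - max_j |g_j(T)|`. -/
def deficiency {U : Type*} {c d ℓ m : ℕ} (ω : HashSeq U c d ℓ m) (T : Finset U) : ℕ :=
  T.card - Finset.univ.sup fun j : Fin c => (T.image (ω.2.1 j)).card

/-- The event `bad_T`. -/
def Bad {U : Type*} {c d ℓ m : ℕ} (T : Finset U) (ω : HashSeq U c d ℓ m) : Prop :=
  1 < deficiency ω T

/-! Edge-labelled multi-hypergraphs. -/

/-- A multi-hypergraph on the vertex set consisting of `d` copies of `[m]` (the vertex `(i, a)` is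
the element `a` of the `i`-th copy), whose edges carry distinct labels from a set of size `n`.
`edge i` is the edge labelled `i`; `edge i = ∅` means that there is no edge labelled `i`. -/
structure LabeledHypergraph (d m n : ℕ) where
  edge : Fin n → Finset (Fin d × Fin m)

namespace LabeledHypergraph

variable {d m n : ℕ}

/-- The set of labels of the edges of `G`. -/
def labels (G : LabeledHypergraph d m n) : Finset (Fin n) :=
  Finset.univ.filter fun i => (G.edge i).Nonempty

/-- The number `|E|` of edges, counted with multiplicity. -/
def numEdges (G : LabeledHypergraph d m n) : ℕ := G.labels.card

/-- Subgraph relation with coinciding labels; vertices may be deleted from single edges. -/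
def IsSubgraph (G G' : LabeledHypergraph d m n) : Prop := ∀ i, G.edge i ⊆ G'.edge i

/-- Two vertices lie on a common edge. -/
def Joined (G : LabeledHypergraph d m n) (u v : Fin d × Fin m) : Prop :=
  ∃ i, u ∈ G.edge i ∧ v ∈ G.edge i

/-- Connectedness, disregarding isolated vertices: any two non-isolated vertices are linked by a
hyperpath. -/
def IsConnected (G : LabeledHypergraph d m n) : Prop :=
  ∀ u v, (∃ i, u ∈ G.edge i) → (∃ i, v ∈ G.edge i) → Relation.ReflTransGen G.Joined u v

/-- The bipartite representation: edge labels on the left, vertices on the right. -/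
def bi (G : LabeledHypergraph d m n) : SimpleGraph (Fin n ⊕ (Fin d × Fin m)) where
  Adj a b := match a, b with
    | .inl i, .inr v => v ∈ G.edge i
    | .inr v, .inl i => v ∈ G.edge i
    | _, _ => False
  symm := ⟨by rintro (i | v) (j | w) h <;> exact h⟩
  loopless := ⟨by rintro (i | v) h <;> exact h⟩

end LabeledHypergraph

/-- `𝒢^d_{m,n}`: the `d`-partite hypergraphs, with `[m]` in each class, whose edges have at least
two vertices (at most one from each class) and carry distinct labels from an `n`-element set. -/
def partiteHypergraphs (d m n : ℕ) : Set (LabeledHypergraph d m n) :=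
  {G | ∀ i, (i ∈ G.labels → 2 ≤ (G.edge i).card) ∧
    ∀ u ∈ G.edge i, ∀ v ∈ G.edge i, u.1 = v.1 → u = v}

/-- The hypergraph `G(S, h)`, for `S = {x_0 < … < x_{n-1}}`: the edge labelled `i` is
`(h_1(x_i), …, h_d(x_i))`. -/
def hashGraph {U : Type*} {c d ℓ m n : ℕ} (x : Fin n → U) (ω : HashSeq U c d ℓ m) :
    LabeledHypergraph d m n where
  edge i := Finset.univ.image fun j : Fin d => (j, ω.eval j (x i))

/-- The event `B^A_S`: some `G ∈ A` is a subgraph of `G(S, h)` and `bad_{T(G)}` occurs, where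
`T(G)` is the set of keys labelling the edges of `G`. -/
def FailureEvent {U : Type*} [LinearOrder U] {c d ℓ m n : ℕ} (S : Finset U) (hS : S.card = n)
    (A : Set (LabeledHypergraph d m n)) (ω : HashSeq U c d ℓ m) : Prop :=
  ∃ G ∈ A, G.IsSubgraph (hashGraph (S.orderEmbOfFin hS) ω) ∧
    Bad (G.labels.image (S.orderEmbOfFin hS)) ω

/-- The failure term `Pr(B^A_S)` of the class `𝒵^{c,d}_{ℓ,m}(F, H)` on `A`. -/
noncomputable def failureTerm {U : Type*} [LinearOrder U] (c : ℕ) {d ℓ m n : ℕ}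
    (F : Finset (U → Fin ℓ)) (H : Finset (U → Fin m)) (S : Finset U) (hS : S.card = n)
    (A : Set (LabeledHypergraph d m n)) : ℝ :=
  uniformProb (hashClassZ c d F H) (FailureEvent S hS A)

/-- `C_small(K, d)`: connected `d`-partite hypergraphs in `𝒢^d_{n/d,n}` with at most `K log₂ n`
edges. -/
def smallConnected (K : ℝ) (d n : ℕ) : Set (LabeledHypergraph d (n / d) n) :=
  {G | G ∈ partiteHypergraphs d (n / d) n ∧ G.IsConnected ∧
    (G.numEdges : ℝ) ≤ K * Real.logb 2 n}

/-- A finite graph `B` together with a suitable root `s` and a shortest path tree `T` rooted at `s`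
is a `(k, t)`-multicycle: `B` is connected with cyclomatic number `k = |E| - |V| + 1`, all distances
from `s` in `T` are at most `t`, and every leaf of the rooted tree `T` is incident to an edge of
`B` outside `T`. -/
def IsMulticycle {W : Type*} (B : SimpleGraph W) (k t : ℕ) : Prop :=
  B.Connected ∧ B.edgeSet.ncard + 1 = Nat.card W + k ∧
    ∃ (s : W) (T : SimpleGraph W), T ≤ B ∧ T.IsTree ∧ (∀ v, T.dist s v = B.dist s v) ∧
      (∀ v, T.dist s v ≤ t) ∧
      ∀ v, v ≠ s → (T.neighborSet v).ncard = 1 → ∃ w, B.Adj v w ∧ ¬ T.Adj v w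

/-- `bi(G)` is, up to isolated vertices, the regular witness tree with `r` levels of job vertices:
the root is a machine vertex, every machine vertex on a level below `r` has `τ` job vertices as
children, and every job vertex has `d - 1` machine vertices as children. The machine vertices are
addressed by lists of length at most `r` (the root is `[]`): the job vertex `(p, a)` is the
`a`-th child of machine `p`, and its children are the machines `p ++ [(a, b)]`. -/
def IsWitnessTree {d m n : ℕ} (τ r : ℕ) (G : LabeledHypergraph d m n) : Prop :=
  ∃ (machine : List (Fin τ × Fin (d - 1)) → Fin d × Fin m)
    (job : List (Fin τ × Fin (d - 1)) × Fin τ → Fin n),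
    Set.InjOn machine {p | p.length ≤ r} ∧ Set.InjOn job {q | q.1.length < r} ∧
    (∀ i, i ∈ G.labels ↔ ∃ q : List (Fin τ × Fin (d - 1)) × Fin τ, q.1.length < r ∧ job q = i) ∧
    ∀ (p : List (Fin τ × Fin (d - 1))) (a : Fin τ), p.length < r →
      G.edge (job (p, a)) =
        insert (machine p) (Finset.univ.image fun b : Fin (d - 1) => machine (p ++ [(a, b)]))

/-- Hypergraphs in `𝒢^d_{n/d,n}` whose bipartite representation, disregarding isolated vertices,
forms a `(k, t)`-multicycle or a regular witness tree with `r` levels of job vertices. -/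
def multicycleOrWitnessTree (d n τ k t r : ℕ) : Set (LabeledHypergraph d (n / d) n) :=
  {G | G ∈ partiteHypergraphs d (n / d) n ∧
    (IsMulticycle (G.bi.induce G.bi.support) k t ∨ IsWitnessTree τ r G)}

/-- The number of job vertices of the regular witness tree with `r` levels of job vertices. -/
def witnessTreeJobs (d τ r : ℕ) : ℕ := ∑ i ∈ Finset.range r, τ * (τ * (d - 1)) ^ i

end HashGraph

/-! A direct union bound over all graphs in the class would need the joint law of the hash values on
key sets where every `g_j` collides heavily. The proof instead shrinks the key set. Explore a small
connected bad graph key by key along hash collisions. The deficiency starts at zero, ends above one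
and grows by at most one per key, so some prefix of u + 1 keys has deficiency exactly one. Such a
critical key set has two useful properties. Every `g_j` has a collision on it, which costs
((u+1)²/ℓ)^c by universality. Some `g_j` takes u distinct values on it, so its random table entries,
with pairwise independence of `f_i` for the one remaining collision, make all hash values on these
keys uniform and independent. Hence the u collisions of the exploration tree cost a factor m^(-u)
(`uniformProb_tree_collision_le`).

The exploration must be cheap to encode. Each pair (position, colour) is scanned once and yields at
most one new key, so the tree is a strictly increasing sequence of scan indices below du, giving at
most 2^(du) shapes (`exists_exploration`, `card_strictMono_le`). With n^(u+1) choices of keys and m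
= n/d, the term for u is at most n (2^d d)^u (u+1)^(2c) / ℓ^c. For u < K log n and d ≥ 2, the factor
(2^d d)^u is at most n^(K(d+1) log d), and the polylogarithmic rest is O(n).

For the second claim, `failureTerm` is monotone in the graph class, and multicycles and witness
trees are connected and small (`IsMulticycle.card_le`, `IsWitnessTree.numEdges_le`). -/

namespace HashGraph

/-! ### Uniform probability and the union bound. -/

section UniformProb

variable {Ω : Type*}

open Classical in
theorem uniformProb_mono {A : Finset Ω} {P Q : Ω → Prop} (h : ∀ ω ∈ A, P ω → Q ω) :
    uniformProb A P ≤ uniformProb A Q := by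
  unfold uniformProb
  refine div_le_div_of_nonneg_right (Nat.cast_le.2 (Finset.card_le_card fun ω hω => ?_))
    (Nat.cast_nonneg _)
  rw [Finset.mem_filter] at hω ⊢
  exact ⟨hω.1, h ω hω.1 hω.2⟩

open Classical in
theorem uniformProb_eq_zero {A : Finset Ω} {P : Ω → Prop} (h : ∀ ω ∈ A, ¬ P ω) :
    uniformProb A P = 0 := by
  simp [uniformProb, Finset.filter_false_of_mem h]

open Classical in
theorem uniformProb_exists_le {ι : Type*} (I : Finset ι) (A : Finset Ω) (P : ι → Ω → Prop) :
    uniformProb A (fun ω => ∃ i ∈ I, P i ω) ≤ ∑ i ∈ I, uniformProb A (P i) := by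
  unfold uniformProb
  rw [← Finset.sum_div]
  gcongr
  rw [← Nat.cast_sum, Nat.cast_le]
  refine le_trans (Finset.card_le_card (t := I.biUnion fun i => A.filter (P i)) fun ω => ?_)
    Finset.card_biUnion_le
  simp only [Finset.mem_filter, Finset.mem_biUnion]
  tauto

open Classical in
theorem card_filter_eq_uniformProb_mul (A : Finset Ω) (P : Ω → Prop) :
    ((A.filter P).card : ℝ) = uniformProb A P * A.card := by
  unfold uniformProb
  rcases A.eq_empty_or_nonempty with rfl | hA
  · simp
  · have : (A.card : ℝ) ≠ 0 := by exact_mod_cast hA.card_pos.ne'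
    field_simp

end UniformProb

/-! ### Collisions under universality; uniformity from the tables and pairwise independence. -/

theorem two_mul_card_lt_pairs_le (t : ℕ) :
    2 * ((Finset.univ : Finset (Fin t × Fin t)).filter fun q => q.1 < q.2).card ≤ t ^ 2 := by
  have h1 : ((Finset.univ : Finset (Fin t × Fin t)).filter fun q => q.1 < q.2).card ≤
      ((Finset.univ : Finset (Fin t × Fin t)).filter fun q => ¬ q.1 < q.2).card := by
    refine Finset.card_le_card_of_injOn Prod.swap ?_ Prod.swap_injective.injOn
    intro q hq
    simp only [Finset.coe_filter, Finset.mem_univ, true_and, Set.mem_ofPred_eq, Prod.fst_swap,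
      Prod.snd_swap, not_lt] at hq ⊢
    exact hq.le
  have h2 := Finset.card_filter_add_card_filter_not (s := (Finset.univ : Finset (Fin t × Fin t)))
    (fun q => q.1 < q.2)
  rw [Finset.card_univ, Fintype.card_prod, Fintype.card_fin] at h2
  nlinarith

theorem IsUniversal.uniformProb_not_injective_le {U : Type*} {ℓ : ℕ} {F : Finset (U → Fin ℓ)}
    (hF : IsUniversal 2 F) {t : ℕ} {x : Fin t → U} (hx : Function.Injective x) :
    uniformProb F (fun g => ¬ Function.Injective (g ∘ x)) ≤ (t : ℝ) ^ 2 / ℓ := by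
  calc uniformProb F (fun g => ¬ Function.Injective (g ∘ x))
      ≤ uniformProb F (fun g => ∃ q ∈ (Finset.univ : Finset (Fin t × Fin t)).filter
          (fun q => q.1 < q.2), g (x q.1) = g (x q.2)) := by
        refine uniformProb_mono fun g _ hg => ?_
        simp only [Function.Injective, not_forall, Function.comp_apply] at hg
        obtain ⟨a, b, hab, hne⟩ := hg
        rcases lt_or_gt_of_ne hne with h | h
        · exact ⟨(a, b), by simpa using h, hab⟩
        · exact ⟨(b, a), by simpa using h, hab.symm⟩
    _ ≤ ∑ q ∈ (Finset.univ : Finset (Fin t × Fin t)).filter (fun q => q.1 < q.2),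
          uniformProb F (fun g => g (x q.1) = g (x q.2)) := uniformProb_exists_le _ _ _
    _ ≤ ∑ _q ∈ (Finset.univ : Finset (Fin t × Fin t)).filter (fun q => q.1 < q.2),
          2 / (ℓ : ℝ) := by
        refine Finset.sum_le_sum fun q hq => hF.2 _ _ fun h => ?_
        exact (Finset.mem_filter.1 hq).2.ne (hx h)
    _ = (2 * (((Finset.univ : Finset (Fin t × Fin t)).filter fun q => q.1 < q.2).card : ℝ)) / ℓ := by
        rw [Finset.sum_const, nsmul_eq_mul]; ring
    _ ≤ (t : ℝ) ^ 2 / ℓ := by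
        gcongr
        exact_mod_cast two_mul_card_lt_pairs_le t

/-- Under pairwise independence, the difference of two hash values is uniformly distributed. -/
theorem IsWiseIndependent.card_filter_sub_eq {U : Type*} {m : ℕ} [NeZero m]
    {H : Finset (U → Fin m)} (hH : IsWiseIndependent 2 H) {a b : U} (hab : a ≠ b) (e : Fin m) :
    (H.filter fun f => f a - f b = e).card * m = H.card := by
  classical
  have hm : (m : ℝ) ≠ 0 := by exact_mod_cast NeZero.ne m
  have key : ∀ y : Fin m, ((H.filter fun f => f a = y + e ∧ f b = y).card : ℝ) =
      H.card / (m : ℝ) ^ 2 := by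
    intro y
    have hinj : Function.Injective ![a, b] := by
      intro i j hij
      fin_cases i <;> fin_cases j <;> simp_all
    have := hH.2 ![a, b] hinj ![y + e, y]
    have h2 := card_filter_eq_uniformProb_mul H (fun h => ∀ i, h (![a, b] i) = ![y + e, y] i)
    rw [this] at h2
    simp only [Fin.forall_fin_two, Matrix.cons_val_zero, Matrix.cons_val_one] at h2
    convert h2 using 1
    ring
  have hsum : (H.filter fun f => f a - f b = e).card =
      ∑ y : Fin m, (H.filter fun f => f a = y + e ∧ f b = y).card := by
    rw [Finset.card_eq_sum_card_fiberwise (f := fun f => f b) (t := Finset.univ)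
      (fun _ _ => Finset.mem_coe.2 (Finset.mem_univ _))]
    refine Finset.sum_congr rfl fun y _ => ?_
    rw [Finset.filter_filter]
    congr 1
    refine Finset.filter_congr fun f _ => ?_
    constructor
    · rintro ⟨h1, rfl⟩
      exact ⟨by rw [← h1]; abel, rfl⟩
    · rintro ⟨h1, rfl⟩
      exact ⟨by rw [h1]; abel, rfl⟩
  have : ((H.filter fun f => f a - f b = e).card : ℝ) * m = H.card := by
    rw [hsum]
    push_cast
    simp only [key, Finset.sum_const, Finset.card_univ, Fintype.card_fin, nsmul_eq_mul]
    field_simp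
  exact_mod_cast this

/-- If one of the `g_j` has deficiency at most one on the keys, then one hash function of the class
is (at most) fully random on these keys. -/
theorem IsWiseIndependent.card_hash_eq_mul_le {U : Type*} {c ℓ m : ℕ} [NeZero m]
    {H : Finset (U → Fin m)} (hH : IsWiseIndependent 2 H) (g : Fin c → U → Fin ℓ)
    {ι : Type*} [Fintype ι] [DecidableEq ι] {x : ι → U} (hx : Function.Injective x) (j₀ : Fin c)
    (hj : Fintype.card ι ≤ (Finset.univ.image fun k => g j₀ (x k)).card + 1) (v : ι → Fin m) :
    ((H ×ˢ (Finset.univ : Finset (Fin c → Fin ℓ → Fin m))).filter fun q =>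
        ∀ k, q.1 (x k) + ∑ j, q.2 j (g j (x k)) = v k).card * m ^ Fintype.card ι ≤
      H.card * m ^ (c * ℓ) := by
  classical
  set T := Finset.univ.image fun k => g j₀ (x k) with hT
  set Z := (Finset.univ : Finset (Fin c → Fin ℓ → Fin m))
  have hZ : Z.card = m ^ (c * ℓ) := by
    simp [Z, Finset.card_univ, ← pow_mul, mul_comm]
  set Sol := (H ×ˢ Z).filter fun q => ∀ k, q.1 (x k) + ∑ j, q.2 j (g j (x k)) = v k with hSol
  let ext (w : T → Fin m) (b : Fin ℓ) : Fin m := if h : b ∈ T then w ⟨b, h⟩ else 0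
  -- Shifting table `j₀` by `w` on the values taken there changes each key's hash by `w` at its `g
  -- j₀`-value, so differences between keys sharing that value survive.
  let sh (w : T → Fin m) (z : Fin c → Fin ℓ → Fin m) : Fin c → Fin ℓ → Fin m :=
    fun j b => z j b + if j = j₀ then ext w b else 0
  have hsum (w : T → Fin m) (z : Fin c → Fin ℓ → Fin m) (y : U) :
      ∑ j, sh w z j (g j y) = ∑ j, z j (g j y) + ext w (g j₀ y) := by
    simp [sh, Finset.sum_add_distrib]
  -- `R` keeps only the shift-invariant part of the equations. Shifts of solutions are pairwise
  -- distinct elements of `R`, which saves a factor `m ^ T.card`.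
  set R := (H ×ˢ Z).filter fun q => ∀ k k', g j₀ (x k) = g j₀ (x k') →
    (q.1 (x k) + ∑ j, q.2 j (g j (x k))) - (q.1 (x k') + ∑ j, q.2 j (g j (x k'))) = v k - v k'
    with hR
  have h1 : Sol.card * m ^ T.card ≤ R.card := by
    have : Sol.card * m ^ T.card = (Sol ×ˢ (Finset.univ : Finset (T → Fin m))).card := by
      simp [Finset.card_product, Finset.card_univ]
    rw [this]
    refine Finset.card_le_card_of_injOn (fun q => (q.1.1, sh q.2 q.1.2)) ?_ ?_
    · rintro ⟨⟨f, z⟩, w⟩ hq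
      simp only [hSol, Finset.coe_product, Finset.coe_univ, Set.mem_prod, Finset.mem_coe,
        Finset.mem_filter, Finset.mem_product, Set.mem_univ, and_true] at hq
      simp only [hR, Finset.coe_filter, Finset.mem_product, Set.mem_ofPred_eq, Z, Finset.mem_univ,
        and_true]
      refine ⟨hq.1.1, fun k k' hkk => ?_⟩
      rw [hsum, hsum, ← add_assoc, ← add_assoc, hq.2 k, hq.2 k', hkk]
      abel
    · rintro ⟨⟨f, z⟩, w⟩ hq ⟨⟨f', z'⟩, w'⟩ hq' heq
      simp only [hSol, Finset.coe_product, Finset.coe_univ, Set.mem_prod, Finset.mem_coe,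
        Finset.mem_filter, Finset.mem_product, Set.mem_univ, and_true] at hq hq'
      simp only [Prod.mk.injEq] at heq
      obtain ⟨rfl, hz⟩ := heq
      have hw : w = w' := by
        funext ⟨b, hb⟩
        obtain ⟨k, -, rfl⟩ := Finset.mem_image.1 hb
        have e1 := hsum w z (x k)
        have e2 := hsum w' z' (x k)
        rw [hz, e2] at e1
        -- Both are solutions with the same `f`, so their table sums agree at `x k`; hence so do the
        -- shifts.
        have e3 := (hq.2 k).trans (hq'.2 k).symm
        have e4 := add_left_cancel e3
        rw [e4] at e1
        have e5 := add_left_cancel e1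
        simp only [ext, dif_pos hb] at e5
        exact e5.symm
      subst hw
      have : z = z' := by
        funext j b
        exact add_right_cancel (congrFun (congrFun hz j) b)
      rw [this]
  have hRle : R.card ≤ H.card * m ^ (c * ℓ) := by
    rw [← hZ, ← Finset.card_product]
    exact Finset.card_filter_le _ _
  by_cases hinj : Function.Injective fun k => g j₀ (x k)
  · have : T.card = Fintype.card ι := by
      rw [hT, Finset.card_image_of_injective _ hinj, Finset.card_univ]
    rw [← this]
    exact h1.trans hRle
  · have hTlt : T.card + 1 = Fintype.card ι := by
      refine le_antisymm ?_ hj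
      refine Nat.succ_le_of_lt (lt_of_le_of_ne Finset.card_image_le ?_)
      intro h
      exact hinj fun a b hab => Finset.card_image_iff.1 h (by simp) (by simp) hab
    simp only [Function.Injective, not_forall] at hinj
    obtain ⟨a, b, hab, hne⟩ := hinj
    -- The one factor `m` still missing comes from the colliding pair: for fixed tables, `R`
    -- prescribes `f (x a) - f (x b)`.
    have h2 : R.card * m ≤ H.card * m ^ (c * ℓ) := by
      have : R.card ≤ ∑ z ∈ Z, (H.filter fun f => f (x a) - f (x b) =
          (v a - v b) - (∑ j, z j (g j (x a)) - ∑ j, z j (g j (x b)))).card := by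
        rw [Finset.card_eq_sum_card_fiberwise (f := Prod.snd) (t := Z)
          (fun _ _ => Finset.mem_coe.2 (Finset.mem_univ _))]
        refine Finset.sum_le_sum fun z _ => ?_
        refine Finset.card_le_card_of_injOn Prod.fst ?_ ?_
        · rintro ⟨f, z'⟩ hq
          simp only [hR, Finset.coe_filter, Finset.mem_filter, Finset.mem_product,
            Set.mem_ofPred_eq] at hq ⊢
          obtain ⟨⟨⟨hf, -⟩, hq⟩, rfl⟩ := hq
          refine ⟨hf, ?_⟩
          rw [← hq a b hab]
          abel
        · rintro ⟨f, z1⟩ h1 ⟨f', z2⟩ h2 h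
          simp only [Finset.coe_filter, Set.mem_ofPred_eq] at h1 h2 h
          rw [h, h1.2, h2.2]
      calc R.card * m ≤ _ := Nat.mul_le_mul_right m this
        _ = H.card * m ^ (c * ℓ) := by
          rw [Finset.sum_mul]
          simp only [hH.card_filter_sub_eq (hx.ne hne), Finset.sum_const, smul_eq_mul, hZ]
          ring
    calc Sol.card * m ^ Fintype.card ι = (Sol.card * m ^ T.card) * m := by
          rw [← hTlt, pow_succ, mul_assoc]
      _ ≤ R.card * m := Nat.mul_le_mul_right m h1
      _ ≤ _ := h2

/-! ### Trees of collisions on a critical key set. -/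

/-- Number of value assignments satisfying a tree of `u` collision constraints. -/
theorem card_tree_collision_mul_le {u d m : ℕ} [NeZero m] (p : Fin u → Fin (u + 1))
    (hp : ∀ k, p k < k.succ) (j : Fin u → Fin d) :
    ((Finset.univ : Finset (Fin (u + 1) → Fin d → Fin m)).filter fun v =>
        ∀ k, v k.succ (j k) = v (p k) (j k)).card * m ^ u ≤ m ^ (d * (u + 1)) := by
  classical
  set Sol := (Finset.univ : Finset (Fin (u + 1) → Fin d → Fin m)).filter fun v =>
        ∀ k, v k.succ (j k) = v (p k) (j k) with hSol
  have e1 : Sol.card * m ^ u = (Sol ×ˢ (Finset.univ : Finset (Fin u → Fin m))).card := by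
    simp [Finset.card_product, Finset.card_univ]
  have e2 : m ^ (d * (u + 1)) = (Finset.univ : Finset (Fin (u + 1) → Fin d → Fin m)).card := by
    simp [Finset.card_univ, ← pow_mul]
  rw [e1, e2]
  -- Overwrite the constrained entry of key `k + 1` by adding a free value `w k`. Nothing is lost,
  -- since the constraint recovers that entry from the earlier key `p k`.
  refine Finset.card_le_card_of_injOn (fun q : (Fin (u + 1) → Fin d → Fin m) × (Fin u → Fin m) =>
    fun k => Fin.cases (q.1 0) (fun k => q.1 k.succ + Pi.single (j k) (q.2 k)) k) (by simp) ?_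
  rintro ⟨v, w⟩ h ⟨v', w'⟩ h' heq
  simp only [hSol, Finset.coe_product, Finset.coe_univ, Set.mem_prod, Finset.mem_coe,
    Finset.mem_filter, Finset.mem_univ, true_and, Set.mem_univ, and_true] at h h'
  have hv : ∀ N : ℕ, ∀ k : Fin (u + 1), (k : ℕ) < N → v k = v' k := by
    intro N
    induction N with
    | zero => intro k hk; omega
    | succ N ih =>
      intro k hk
      induction k using Fin.cases with
      | zero => simpa using congrFun heq 0
      | succ k =>
        have hk' := congrFun heq k.succ
        simp only [Fin.cases_succ] at hk'
        funext i
        by_cases hi : i = j k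
        · subst hi
          rw [h k, h' k, ih (p k)]
          have := hp k
          rw [Fin.lt_def] at this
          omega
        · have := congrFun hk' i
          simpa [hi] using this
  have hvv : v = v' := funext fun k => hv _ k (Nat.lt_succ_self _)
  subst hvv
  have : w = w' := by
    funext k
    have hk' := congrFun (congrFun heq k.succ) (j k)
    simpa using hk'
  rw [this]

/-- Replaces the sum of natural numbers reduced modulo `m` by addition in `Fin m`, so that group
cancellation applies. -/
theorem HashSeq.eval_eq_add_sum {U : Type*} {c d ℓ m : ℕ} [NeZero m] (ω : HashSeq U c d ℓ m)
    (i : Fin d) (x : U) : ω.eval i x = ω.1 i x + ∑ j, ω.2.2 i j (ω.2.1 j x) := by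
  have hs : ∀ s : Finset (Fin c), ((∑ j ∈ s, ω.2.2 i j (ω.2.1 j x) : Fin m) : ℕ) =
      (∑ j ∈ s, (ω.2.2 i j (ω.2.1 j x) : ℕ)) % m := by
    classical
    intro s
    induction s using Finset.induction_on with
    | empty => simp
    | insert a s ha ih => rw [Finset.sum_insert ha, Finset.sum_insert ha, Fin.val_add, ih,
        Nat.add_mod_mod]
  ext
  rw [Fin.val_add, hs, Nat.add_mod_mod]
  rfl

/-- Collisions along a tree, for fixed `g` of deficiency at most one on the keys. -/
theorem IsWiseIndependent.card_tree_collision_mul_le {U : Type*} {c d ℓ m u : ℕ} [NeZero m]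
    {H : Finset (U → Fin m)} (hH : IsWiseIndependent 2 H) (g : Fin c → U → Fin ℓ)
    {x : Fin (u + 1) → U} (hx : Function.Injective x) (j₀ : Fin c)
    (hj₀ : u ≤ (Finset.univ.image fun k => g j₀ (x k)).card) (p : Fin u → Fin (u + 1))
    (hp : ∀ k, p k < k.succ) (j : Fin u → Fin d) :
    (((Fintype.piFinset fun _ : Fin d => H) ×ˢ
        (Finset.univ : Finset (Fin d → Fin c → Fin ℓ → Fin m))).filter fun q =>
        ∀ k, HashSeq.eval (q.1, g, q.2) (j k) (x k.succ) =
          HashSeq.eval (q.1, g, q.2) (j k) (x (p k))).card * m ^ u ≤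
      (H.card * m ^ (c * ℓ)) ^ d := by
  classical
  set A := (Fintype.piFinset fun _ : Fin d => H) ×ˢ
        (Finset.univ : Finset (Fin d → Fin c → Fin ℓ → Fin m)) with hA
  set B := A.filter fun q => ∀ k, HashSeq.eval (q.1, g, q.2) (j k) (x k.succ) =
          HashSeq.eval (q.1, g, q.2) (j k) (x (p k)) with hB
  set V := (Finset.univ : Finset (Fin (u + 1) → Fin d → Fin m)).filter fun v =>
        ∀ k, v k.succ (j k) = v (p k) (j k) with hV
  set N := H.card * m ^ (c * ℓ) with hN
  let M (v : Fin (u + 1) → Fin d → Fin m) :=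
    A.filter fun q => ∀ k i, HashSeq.eval (q.1, g, q.2) i (x k) = v k i
  have hm : 0 < m := Nat.pos_of_ne_zero (NeZero.ne m)
  -- For fixed `g`, the `d` coordinates use separate `f_i` and tables, so the count factors over
  -- `i`.
  have hM (v) : (M v).card * m ^ (d * (u + 1)) ≤ N ^ d := by
    let L (i : Fin d) := (H ×ˢ (Finset.univ : Finset (Fin c → Fin ℓ → Fin m))).filter fun q =>
        ∀ k, q.1 (x k) + ∑ j, q.2 j (g j (x k)) = v k i
    have h1 : (M v).card ≤ (Fintype.piFinset L).card := by
      refine Finset.card_le_card_of_injOn (fun q i => (q.1 i, q.2 i)) ?_ ?_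
      · rintro ⟨f, z⟩ hq
        simp only [M, A, Finset.coe_filter, Finset.mem_product, Fintype.mem_piFinset,
          Finset.mem_univ, and_true, Set.mem_ofPred_eq] at hq
        simp only [Finset.mem_coe, Fintype.mem_piFinset, L, Finset.mem_filter, Finset.mem_product,
          Finset.mem_univ, and_true]
        intro i
        refine ⟨hq.1 i, fun k => ?_⟩
        rw [← hq.2 k i, HashSeq.eval_eq_add_sum]
      · rintro ⟨f, z⟩ _ ⟨f', z'⟩ _ h
        have h' := fun i => congrFun h i
        simp only [Prod.mk.injEq] at h' ⊢
        exact ⟨funext fun i => (h' i).1, funext fun i => (h' i).2⟩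
    calc (M v).card * m ^ (d * (u + 1)) ≤ (∏ i, (L i).card) * m ^ (d * (u + 1)) := by
          rw [← Fintype.card_piFinset]; exact Nat.mul_le_mul_right _ h1
      _ = ∏ i, ((L i).card * m ^ (u + 1)) := by
          rw [Finset.prod_mul_distrib, Finset.prod_const, Finset.card_univ, Fintype.card_fin,
            ← pow_mul, mul_comm d]
      _ ≤ ∏ _i : Fin d, N := by
          refine Finset.prod_le_prod (fun _ _ => Nat.zero_le _) fun i _ => ?_
          have := hH.card_hash_eq_mul_le g hx j₀ (by simpa using hj₀) (fun k => v k i)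
          rw [Fintype.card_fin] at this
          refine le_trans (le_of_eq ?_) this
          congr 2
          ext q
          simp only [L, Finset.mem_filter]
      _ = N ^ d := by simp
  have hBM : B.card ≤ ∑ v ∈ V, (M v).card := by
    refine le_trans (Finset.card_le_card (t := V.biUnion M) fun q hq => ?_) Finset.card_biUnion_le
    rw [hB, Finset.mem_filter] at hq
    refine Finset.mem_biUnion.2 ⟨fun k i => HashSeq.eval (q.1, g, q.2) i (x k), ?_, ?_⟩
    · rw [hV, Finset.mem_filter]
      exact ⟨Finset.mem_univ _, hq.2⟩
    · exact Finset.mem_filter.2 ⟨hq.1, fun _ _ => rfl⟩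
  have hVc : V.card * m ^ u ≤ m ^ (d * (u + 1)) := by
    have := HashGraph.card_tree_collision_mul_le (m := m) p hp j
    convert this
  refine Nat.le_of_mul_le_mul_right (c := m ^ (d * (u + 1))) ?_ (by positivity)
  calc B.card * m ^ u * m ^ (d * (u + 1))
      ≤ (∑ v ∈ V, (M v).card) * m ^ u * m ^ (d * (u + 1)) := by gcongr
    _ = (∑ v ∈ V, (M v).card * m ^ (d * (u + 1))) * m ^ u := by
          rw [mul_right_comm, Finset.sum_mul]
    _ ≤ (∑ _v ∈ V, N ^ d) * m ^ u := by gcongr with v _; exact hM v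
    _ = (V.card * m ^ u) * N ^ d := by rw [Finset.sum_const, smul_eq_mul]; ring
    _ ≤ m ^ (d * (u + 1)) * N ^ d := by gcongr
    _ = N ^ d * m ^ (d * (u + 1)) := mul_comm _ _

/-- The probability that a fixed tree of collisions occurs and its key set is critical. -/
theorem uniformProb_tree_collision_le {U : Type*} {c d ℓ m u : ℕ} [NeZero m] (hc : 1 ≤ c)
    {F : Finset (U → Fin ℓ)} (hF : IsUniversal 2 F)
    {H : Finset (U → Fin m)} (hH : IsWiseIndependent 2 H)
    {x : Fin (u + 1) → U} (hx : Function.Injective x) (p : Fin u → Fin (u + 1))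
    (hp : ∀ k, p k < k.succ) (j : Fin u → Fin d) (T : Finset U)
    (hT : ∀ y, y ∈ T ↔ ∃ k, x k = y) :
    uniformProb (hashClassZ c d F H) (fun ω => deficiency ω T = 1 ∧
        ∀ k, ω.eval (j k) (x k.succ) = ω.eval (j k) (x (p k))) ≤
      (((u : ℝ) + 1) ^ 2 / ℓ) ^ c * (1 / (m : ℝ)) ^ u := by
  classical
  have hm : (0 : ℝ) < m := by exact_mod_cast Nat.pos_of_ne_zero (NeZero.ne m)
  have hTx : T = Finset.univ.image x := by ext y; simp [hT]
  have hTc : T.card = u + 1 := by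
    rw [hTx, Finset.card_image_of_injective _ hx, Finset.card_univ, Fintype.card_fin]
  have himg (g : U → Fin ℓ) : T.image g = Finset.univ.image fun k => g (x k) := by
    rw [hTx, Finset.image_image]; rfl
  have : Nonempty (Fin c) := ⟨⟨0, hc⟩⟩
  set E := (hashClassZ c d F H).filter (fun ω => deficiency ω T = 1 ∧
        ∀ k, ω.eval (j k) (x k.succ) = ω.eval (j k) (x (p k))) with hE
  set Fb := F.filter fun g => ¬ Function.Injective (g ∘ x) with hFb
  set P := Fintype.piFinset fun _ : Fin c => Fb with hP
  set N := H.card * m ^ (c * ℓ) with hN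
  -- As `T` has `u + 1` keys, deficiency one says that the largest image has size exactly `u`. As an
  -- upper bound this makes every `g_j` non-injective; as an attained value it supplies `j₀`.
  have hsup (ω : HashSeq U c d ℓ m) (hω : deficiency ω T = 1) :
      (Finset.univ.sup fun j : Fin c => (T.image (ω.2.1 j)).card) = u := by
    unfold deficiency at hω
    omega
  have hmap : ∀ ω ∈ E, ω.2.1 ∈ P := by
    intro ω hω
    simp only [hE, hashClassZ, Finset.mem_filter, Finset.mem_product, Fintype.mem_piFinset] at hω
    simp only [hP, Fintype.mem_piFinset, hFb, Finset.mem_filter]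
    refine fun i => ⟨hω.1.2.1 i, fun hinj => ?_⟩
    have h1 := hsup ω hω.2.1
    have h2 : (T.image (ω.2.1 i)).card ≤ _ :=
      Finset.le_sup (f := fun j : Fin c => (T.image (ω.2.1 j)).card) (Finset.mem_univ i)
    have h3 : (Finset.univ.image fun k => ω.2.1 i (x k)).card = u + 1 := by
      have := Finset.card_image_of_injective Finset.univ hinj
      rwa [Finset.card_univ, Fintype.card_fin] at this
    rw [h1, himg, h3] at h2
    omega
  have hfib : ∀ g ∈ P, (E.filter fun ω => ω.2.1 = g).card * m ^ u ≤ N ^ d := by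
    intro g _
    -- The deficiency depends on `g` only, so any element of a nonempty fibre yields a `j₀` valid
    -- for the whole fibre.
    rcases (E.filter fun ω => ω.2.1 = g).eq_empty_or_nonempty with h0 | ⟨ω, hω⟩
    · simp [h0]
    · obtain ⟨hωE, rfl⟩ := Finset.mem_filter.1 hω
      have hs := hsup ω (Finset.mem_filter.1 hωE).2.1
      obtain ⟨j₀, -, hj₀⟩ := Finset.exists_mem_eq_sup Finset.univ Finset.univ_nonempty
        (fun j : Fin c => (T.image (ω.2.1 j)).card)
      rw [hs, himg] at hj₀
      refine le_trans (Nat.mul_le_mul_right _ ?_)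
        (hH.card_tree_collision_mul_le ω.2.1 hx j₀ hj₀.le p hp j)
      refine Finset.card_le_card_of_injOn (fun ω => (ω.1, ω.2.2)) ?_ ?_
      · rintro ⟨f, g, z⟩ h
        simp only [Finset.coe_filter, hE, Finset.mem_filter, hashClassZ, Finset.mem_product,
          Fintype.mem_piFinset, Set.mem_ofPred_eq, Finset.mem_univ, and_true] at h ⊢
        obtain ⟨⟨⟨hf, -⟩, -, hcol⟩, rfl⟩ := h
        exact ⟨hf, hcol⟩
      · rintro ⟨f, g, z⟩ h ⟨f', g', z'⟩ h' heq
        simp only [Finset.coe_filter, Set.mem_ofPred_eq] at h h'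
        simp only [Prod.mk.injEq] at heq ⊢
        exact ⟨heq.1, h.2.trans h'.2.symm, heq.2⟩
  have hcard : E.card * m ^ u ≤ Fb.card ^ c * N ^ d := by
    rw [Finset.card_eq_sum_card_fiberwise (f := fun ω : HashSeq U c d ℓ m => ω.2.1) (t := P)
      (fun ω hω => hmap ω hω), Finset.sum_mul]
    refine (Finset.sum_le_sum hfib).trans ?_
    simp [hP]
  have hZ : (hashClassZ c d F H).card = F.card ^ c * N ^ d := by
    simp only [hashClassZ, Finset.card_product, Fintype.card_piFinset, Finset.prod_const,
      Finset.card_univ, Fintype.card_fin, Fintype.card_pi, hN, mul_pow, ← pow_mul]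
    ring
  have hFbc : (Fb.card : ℝ) ≤ ((u : ℝ) + 1) ^ 2 / ℓ * F.card := by
    have h1 := card_filter_eq_uniformProb_mul F (fun g => ¬ Function.Injective (g ∘ x))
    have h2 := hF.uniformProb_not_injective_le hx
    push_cast at h2
    have h3 : (Fb.card : ℝ) = uniformProb F (fun g => ¬ Function.Injective (g ∘ x)) * F.card := by
      rw [← h1, hFb]
      congr
    rw [h3]
    gcongr
  have hFpos : (0 : ℝ) < F.card := by exact_mod_cast hF.1.card_pos
  have hNpos : (0 : ℝ) < N := by
    have : 0 < H.card := hH.1.card_pos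
    have : 0 < m := Nat.pos_of_ne_zero (NeZero.ne m)
    rw [hN]; positivity
  have hEq : uniformProb (hashClassZ c d F H) (fun ω => deficiency ω T = 1 ∧
        ∀ k, ω.eval (j k) (x k.succ) = ω.eval (j k) (x (p k))) =
      (E.card : ℝ) / ((F.card : ℝ) ^ c * (N : ℝ) ^ d) := by
    unfold uniformProb
    rw [hZ]
    push_cast
    rw [hE]
    congr
  rw [hEq, div_le_iff₀ (by positivity)]
  have hcardR : (E.card : ℝ) * (m : ℝ) ^ u ≤ (Fb.card : ℝ) ^ c * (N : ℝ) ^ d := by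
    exact_mod_cast hcard
  have h4 : (E.card : ℝ) ≤ (Fb.card : ℝ) ^ c * (N : ℝ) ^ d * (1 / (m : ℝ)) ^ u := by
    rw [one_div, inv_pow, ← div_eq_mul_inv, le_div_iff₀ (by positivity)]
    exact hcardR
  calc (E.card : ℝ) ≤ (Fb.card : ℝ) ^ c * (N : ℝ) ^ d * (1 / (m : ℝ)) ^ u := h4
    _ ≤ (((u : ℝ) + 1) ^ 2 / ℓ * F.card) ^ c * (N : ℝ) ^ d * (1 / (m : ℝ)) ^ u := by gcongr
    _ = _ := by rw [mul_pow]; ring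

/-! ### Exploration with at most one new key per scanned pair. -/

/-- Breadth-first exploration: the data produced after scanning `σ` pairs (position, colour), where
the pair `(p, j)` is encoded as `p * d + j`. The keys `x 0, …, x t` have been found, the key
`x (k + 1)` when scanning the pair `s k`. -/
theorem exists_exploration_aux {V : Type*} {d : ℕ} (hd : 0 < d)
    (R : Fin d → V → V → Prop) (T : Finset V) {y₀ : V} (hy₀ : y₀ ∈ T) (σ : ℕ) :
    ∃ (t : ℕ) (x : ℕ → V) (s : ℕ → ℕ),
      (∀ k ≤ t, x k ∈ T) ∧ Set.InjOn x (Set.Iic t) ∧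
      (∀ k < t, s k / d ≤ k) ∧ (∀ k < t, s k < σ) ∧ (∀ k k', k < k' → k' < t → s k < s k') ∧
      (∀ k < t, R ⟨s k % d, Nat.mod_lt _ hd⟩ (x (k + 1)) (x (s k / d))) ∧
      (∀ q < σ, q / d ≤ t → ∀ y ∈ T, (∀ k ≤ t, x k ≠ y) → R ⟨q % d, Nat.mod_lt _ hd⟩ y (x (q / d)) →
        ∃ k, q / d < k ∧ k ≤ t ∧ R ⟨q % d, Nat.mod_lt _ hd⟩ (x k) (x (q / d))) := by
  induction σ with
  | zero =>
    exact ⟨0, fun _ => y₀, fun _ => 0, fun _ _ => hy₀, fun a ha b hb _ => by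
      simp only [Set.mem_Iic] at ha hb; omega, by simp, by simp, fun _ _ _ h => by omega,
      by simp, by simp⟩
  | succ σ ih =>
    obtain ⟨t, x, s, hxT, hinj, hpar, hlt, hmono, hR, hgr⟩ := ih
    -- Further keys related to `x (σ / d)` in this colour are left over. The last invariant records
    -- that a later found key of the same class can take over the search for them.
    by_cases h : σ / d ≤ t ∧ ∃ y ∈ T, (∀ k ≤ t, x k ≠ y) ∧
        R ⟨σ % d, Nat.mod_lt _ hd⟩ y (x (σ / d))
    · obtain ⟨hσt, y, hyT, hyx, hyR⟩ := h
      have hx' : ∀ k ≤ t, Function.update x (t + 1) y k = x k := fun k hk =>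
        Function.update_of_ne (by omega) _ _
      have hs' : ∀ k < t, Function.update s t σ k = s k := fun k hk =>
        Function.update_of_ne (by omega) _ _
      refine ⟨t + 1, Function.update x (t + 1) y, Function.update s t σ, ?_, ?_, ?_, ?_, ?_, ?_, ?_⟩
      · intro k hk
        rcases Nat.lt_or_ge t k with h | h
        · obtain rfl : k = t + 1 := by omega
          simpa using hyT
        · rw [hx' k h]; exact hxT k h
      · intro a ha b hb hab
        simp only [Set.mem_Iic] at ha hb
        rcases Nat.lt_or_ge t a with h | h <;> rcases Nat.lt_or_ge t b with h' | h'
        · omega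
        · obtain rfl : a = t + 1 := by omega
          rw [hx' b h', Function.update_self] at hab
          exact absurd hab.symm (hyx b h')
        · obtain rfl : b = t + 1 := by omega
          rw [hx' a h, Function.update_self] at hab
          exact absurd hab (hyx a h)
        · rw [hx' a h, hx' b h'] at hab
          exact hinj h h' hab
      · intro k hk
        rcases Nat.lt_or_ge k t with h | h
        · rw [hs' k h]; exact hpar k h
        · obtain rfl : k = t := by omega
          simpa using hσt
      · intro k hk
        rcases Nat.lt_or_ge k t with h | h
        · rw [hs' k h]; exact (hlt k h).trans (Nat.lt_succ_self _)
        · obtain rfl : k = t := by omega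
          simp
      · intro k k' hk hk'
        rw [hs' k (by omega)]
        rcases Nat.lt_or_ge k' t with h | h
        · rw [hs' k' h]; exact hmono k k' hk h
        · obtain rfl : k' = t := by omega
          rw [Function.update_self]
          exact hlt k hk
      · intro k hk
        rcases Nat.lt_or_ge k t with h | h
        · have := hpar k h
          simp only [hs' k h]
          rw [hx' (k + 1) h, hx' (s k / d) (by omega)]
          exact hR k h
        · obtain rfl : k = t := by omega
          simp only [Function.update_self]
          rw [hx' _ hσt]
          exact hyR
      · intro q hq _ y' hy'T hy'x hy'R
        -- A key is added only while the scanned position has already been found, so all earlier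
        -- scans satisfied the position bound too and the old invariant applies.
        have hqt : q / d ≤ t := (Nat.div_le_div_right (Nat.lt_succ_iff.1 hq)).trans hσt
        rw [hx' _ hqt] at hy'R ⊢
        rcases Nat.lt_or_ge q σ with h | h
        · obtain ⟨k, hk1, hk2, hk3⟩ := hgr q h hqt y' hy'T
            (fun k hk => by rw [← hx' k hk]; exact hy'x k (by omega)) hy'R
          exact ⟨k, hk1, by omega, by rw [hx' k hk2]; exact hk3⟩
        · obtain rfl : q = σ := by omega
          exact ⟨t + 1, by omega, le_rfl, by rw [Function.update_self]; exact hyR⟩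
    · refine ⟨t, x, s, hxT, hinj, hpar, fun k hk => (hlt k hk).trans (Nat.lt_succ_self _), hmono,
        hR, ?_⟩
      intro q hq hqt y hyT hyx hyR
      rcases Nat.lt_or_ge q σ with h' | h'
      · exact hgr q h' hqt y hyT hyx hyR
      · obtain rfl : q = σ := by omega
        exact absurd ⟨hqt, y, hyT, hyx, hyR⟩ h

/-- A finite set that is connected under a union of `d` equivalence relations can be explored
completely. -/
theorem exists_exploration {V : Type*} [DecidableEq V] {d : ℕ} (hd : 0 < d)
    (R : Fin d → V → V → Prop) (hRe : ∀ j, Equivalence (R j)) (T : Finset V) (hT : T.Nonempty)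
    (hconn : ∀ D ⊆ T, D.Nonempty → D ≠ T → ∃ a ∈ D, ∃ b ∈ T, b ∉ D ∧ ∃ j, R j b a) :
    ∃ (t : ℕ) (x : ℕ → V) (s : ℕ → ℕ),
      (∀ y, y ∈ T ↔ ∃ k ≤ t, x k = y) ∧ Set.InjOn x (Set.Iic t) ∧
      (∀ k < t, s k / d ≤ k) ∧ (∀ k k', k < k' → k' < t → s k < s k') ∧
      (∀ k < t, R ⟨s k % d, Nat.mod_lt _ hd⟩ (x (k + 1)) (x (s k / d))) := by
  obtain ⟨y₀, hy₀⟩ := hT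
  obtain ⟨t, x, s, hxT, hinj, hpar, -, hmono, hR, hgr⟩ :=
    -- At most `T.card` positions are ever found, each with `d` colours, so this many scans suffice.
    exists_exploration_aux hd R T hy₀ (d * T.card)
  refine ⟨t, x, s, ?_, hinj, hpar, hmono, hR⟩
  set D := (Finset.range (t + 1)).image x with hD
  have hmem : ∀ y, y ∈ D ↔ ∃ k ≤ t, x k = y := by
    intro y; simp [hD]
  have hDT : D ⊆ T := fun y hy => by
    obtain ⟨k, hk, rfl⟩ := (hmem y).1 hy
    exact hxT k hk
  have htT : t + 1 ≤ T.card := by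
    rw [← Finset.card_range (t + 1), ← Finset.card_image_of_injOn (f := x)]
    · exact Finset.card_le_card hDT
    · intro a ha b hb hab
      simp only [Finset.coe_range, Set.mem_Iio] at ha hb
      exact hinj (Nat.lt_succ_iff.1 ha) (Nat.lt_succ_iff.1 hb) hab
  have hDeq : D = T := by
    by_contra hne
    obtain ⟨a, ha, b, hbT, hbD, j, hab⟩ := hconn D hDT ⟨x 0, (hmem _).2 ⟨0, by simp, rfl⟩⟩ hne
    obtain ⟨k₀, hk₀, rfl⟩ := (hmem a).1 ha
    have hbx : ∀ k ≤ t, x k ≠ b := fun k hk h => hbD ((hmem b).2 ⟨k, hk, h⟩)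
    classical
    -- Take the last found key in the `R j`-class of the missed key `b`. Scanning it in colour `j`
    -- must have left a still later key of that class, a contradiction.
    set p := Nat.findGreatest (fun k => R j b (x k)) t with hp
    have hpR : R j b (x p) := Nat.findGreatest_spec (P := fun k => R j b (x k)) hk₀ hab
    have hpt : p ≤ t := Nat.findGreatest_le t
    have hdiv : (p * d + j) / d = p := by
      rw [Nat.mul_comm, Nat.mul_add_div hd, Nat.div_eq_of_lt j.2, add_zero]
    have hmod : (⟨(p * d + j) % d, Nat.mod_lt _ hd⟩ : Fin d) = j := by
      ext
      change (p * d + j) % d = j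
      rw [Nat.mul_comm, Nat.mul_add_mod, Nat.mod_eq_of_lt j.2]
    have hq : p * d + j < d * T.card := by
      have := j.2
      calc p * d + j < p * d + d := by omega
        _ = d * (p + 1) := by ring
        _ ≤ d * T.card := Nat.mul_le_mul_left _ (by omega)
    obtain ⟨k, hk1, hk2, hk3⟩ := hgr _ hq (by rw [hdiv]; exact hpt) b hbT hbx
      (by rw [hdiv, hmod]; exact hpR)
    rw [hdiv] at hk1
    rw [hdiv, hmod] at hk3
    have hbk : R j b (x k) := (hRe j).trans hpR ((hRe j).symm hk3)
    have := Nat.le_findGreatest (P := fun k => R j b (x k)) hk2 hbk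
    omega
  intro y
  rw [← hDeq, hmem]

/-! ### Critical prefixes, and trees of collisions from failures. -/

/-- The cardinality rises by at most one and no image shrinks. This unit step is what prevents the
deficiency from jumping over one. -/
theorem deficiency_insert_le {U : Type*} [DecidableEq U] {c d ℓ m : ℕ} (ω : HashSeq U c d ℓ m)
    (a : U) (T : Finset U) : deficiency ω (insert a T) ≤ deficiency ω T + 1 := by
  unfold deficiency
  have h1 := Finset.card_insert_le a T
  have h2 : (Finset.univ.sup fun j : Fin c => (T.image (ω.2.1 j)).card) ≤
      Finset.univ.sup fun j : Fin c => ((insert a T).image (ω.2.1 j)).card :=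
    Finset.sup_mono_fun fun j _ =>
      Finset.card_le_card (Finset.image_subset_image (Finset.subset_insert a T))
  omega

/-- Some prefix of a sequence of keys with a bad key set is critical. -/
theorem exists_prefix_deficiency_eq_one {U : Type*} [DecidableEq U] {c d ℓ m : ℕ}
    (ω : HashSeq U c d ℓ m) (x : ℕ → U) (t : ℕ)
    (h : 1 < deficiency ω ((Finset.range (t + 1)).image x)) :
    ∃ u ≤ t, deficiency ω ((Finset.range (u + 1)).image x) = 1 := by
  have hex : ∃ u, 1 ≤ deficiency ω ((Finset.range (u + 1)).image x) := ⟨t, h.le⟩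
  classical
  refine ⟨Nat.find hex, Nat.find_min' hex h.le, le_antisymm ?_ (Nat.find_spec hex)⟩
  have hstep : ∀ u, deficiency ω ((Finset.range (u + 1)).image x) ≤
      deficiency ω ((Finset.range u).image x) + 1 := by
    intro u
    rw [Finset.range_add_one, Finset.image_insert]
    exact deficiency_insert_le _ _ _
  refine (hstep _).trans ?_
  rcases Nat.eq_zero_or_pos (Nat.find hex) with h0 | h0
  · rw [h0]; simp [deficiency]
  · have := Nat.find_min hex (m := Nat.find hex - 1) (by omega)
    rw [Nat.sub_add_cancel h0] at this
    omega

/-- In a connected hypergraph, every proper nonempty subset of the labels is linked by a common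
vertex to the remaining labels. -/
theorem LabeledHypergraph.IsConnected.exists_crossing {d m n : ℕ} {G : LabeledHypergraph d m n}
    (hG : G.IsConnected) {D : Finset (Fin n)} (hD : D ⊆ G.labels) (hne : D.Nonempty)
    (hDG : D ≠ G.labels) :
    ∃ a ∈ D, ∃ b ∈ G.labels, b ∉ D ∧ ∃ v, v ∈ G.edge a ∧ v ∈ G.edge b := by
  obtain ⟨i, hi⟩ := hne
  obtain ⟨i', hi', hi'D⟩ : ∃ i' ∈ G.labels, i' ∉ D := by
    by_contra! h
    exact hDG (Finset.Subset.antisymm hD h)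
  have hlab : ∀ i, i ∈ G.labels ↔ (G.edge i).Nonempty := by
    intro i; simp [LabeledHypergraph.labels]
  obtain ⟨w, hw⟩ := (hlab i).1 (hD hi)
  obtain ⟨w', hw'⟩ := (hlab i').1 hi'
  by_contra! hcon
  -- Without a crossing, a hyperpath that starts on an edge of `D` uses only edges of `D`.
  have : ∃ a ∈ D, w' ∈ G.edge a := by
    have hpath := hG w w' ⟨i, hw⟩ ⟨i', hw'⟩
    clear hw'
    induction hpath with
    | refl => exact ⟨i, hi, hw⟩
    | tail _ hstep ih =>
      obtain ⟨a, ha, hba⟩ := ih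
      obtain ⟨b, hb1, hb2⟩ := hstep
      refine ⟨b, ?_, hb2⟩
      by_contra hbD
      exact hcon a ha b ((hlab b).2 ⟨_, hb1⟩) hbD _ hba hb1
  obtain ⟨a, ha, hwa⟩ := this
  exact hcon a ha i' hi' hi'D w' hwa hw'

/-- A failure on a small connected hypergraph yields a tree of collisions on a critical key set. -/
theorem FailureEvent.exists_tree_collision {U : Type*} [LinearOrder U] {c d ℓ n : ℕ} {K : ℝ}
    (hd : 0 < d) {S : Finset U} {hS : S.card = n} {ω : HashSeq U c d ℓ (n / d)}
    (h : FailureEvent S hS (smallConnected K d n) ω) :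
    ∃ u ∈ Finset.range ⌊K * Real.logb 2 n⌋₊,
      ∃ q : (Fin (u + 1) → Fin n) × (Fin u → Fin (d * u)),
        Function.Injective q.1 ∧ StrictMono q.2 ∧ (∀ k, (q.2 k : ℕ) / d ≤ k) ∧
        deficiency ω (Finset.univ.image fun k => S.orderEmbOfFin hS (q.1 k)) = 1 ∧
        ∀ k, ∀ p : Fin (u + 1), (p : ℕ) = q.2 k / d →
          ω.eval ⟨q.2 k % d, Nat.mod_lt _ hd⟩ (S.orderEmbOfFin hS (q.1 k.succ)) =
          ω.eval ⟨q.2 k % d, Nat.mod_lt _ hd⟩ (S.orderEmbOfFin hS (q.1 p)) := by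
  obtain ⟨G, ⟨-, hconn, hsize⟩, hsub, hbad⟩ := h
  set X := S.orderEmbOfFin hS with hX
  have hTne : G.labels.Nonempty := by
    rw [Finset.nonempty_iff_ne_empty]
    intro h0
    simp [Bad, h0, deficiency] at hbad
  obtain ⟨t, x, s, hxT, hinj, hpar, hmono, hR⟩ := exists_exploration hd
    (fun j a b => ω.eval j (X a) = ω.eval j (X b))
    (fun j => ⟨fun _ => rfl, fun h => h.symm, fun h h' => h.trans h'⟩) G.labels hTne (by
      intro D hD hne hDG
      obtain ⟨a, ha, b, hb, hbD, ⟨j, v⟩, hva, hvb⟩ := hconn.exists_crossing hD hne hDG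
      refine ⟨a, ha, b, hb, hbD, j, ?_⟩
      have h1 := hsub a hva
      have h2 := hsub b hvb
      simp only [hashGraph, Finset.mem_image, Finset.mem_univ, true_and, Prod.mk.injEq] at h1 h2
      obtain ⟨j1, rfl, h1⟩ := h1
      obtain ⟨j2, rfl, h2⟩ := h2
      rw [h1, h2])
  have himg : G.labels.image X = (Finset.range (t + 1)).image fun k => X (x k) := by
    ext y
    simp only [Finset.mem_image, hxT, Finset.mem_range, Nat.lt_succ_iff]
    constructor
    · rintro ⟨_, ⟨k, hk, rfl⟩, rfl⟩; exact ⟨k, hk, rfl⟩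
    · rintro ⟨k, hk, rfl⟩; exact ⟨_, ⟨k, hk, rfl⟩, rfl⟩
  unfold Bad at hbad
  rw [himg] at hbad
  obtain ⟨u, hut, hu⟩ := exists_prefix_deficiency_eq_one ω (fun k => X (x k)) t hbad
  -- The keys number `t + 1`, so `u + 1` is at most the number of edges; hence the strict bound on
  -- `u`.
  have hcard : t + 1 ≤ G.labels.card := by
    rw [← Finset.card_range (t + 1)]
    refine Finset.card_le_card_of_injOn x ?_ ?_
    · intro k hk
      simp only [Finset.coe_range, Set.mem_Iio, Nat.lt_succ_iff] at hk
      exact (hxT _).2 ⟨k, hk, rfl⟩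
    · intro a ha b hb hab
      simp only [Finset.coe_range, Set.mem_Iio] at ha hb
      exact hinj (Nat.lt_succ_iff.1 ha) (Nat.lt_succ_iff.1 hb) hab
  refine ⟨u, ?_, (fun k => x k, fun k => ⟨s k, ?_⟩), ?_, ?_, ?_, ?_, ?_⟩
  · rw [Finset.mem_range]
    have : G.labels.card ≤ ⌊K * Real.logb 2 n⌋₊ := Nat.le_floor hsize
    omega
  · have h1 := hpar k (by omega)
    have h2 := k.2
    rw [mul_comm, ← Nat.div_lt_iff_lt_mul hd]
    omega
  · intro a b hab
    have := hinj (Set.mem_Iic.2 (by omega)) (Set.mem_Iic.2 (by omega)) hab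
    exact Fin.ext this
  · intro a b hab
    exact hmono a b hab (by omega)
  · intro k
    exact hpar k (by omega)
  · refine Eq.trans (congrArg _ ?_) hu
    ext y
    simp only [Finset.mem_image, Finset.mem_univ, true_and, Finset.mem_range]
    constructor
    · rintro ⟨k, rfl⟩; exact ⟨k, k.2, rfl⟩
    · rintro ⟨k, hk, rfl⟩; exact ⟨⟨k, hk⟩, rfl⟩
  · intro k p hp
    simp only at hp ⊢
    rw [hp]
    exact hR k (by omega)

/-! ### Counting the encodings and evaluating the sum. -/

/-- A strictly increasing sequence is determined by its range, a subset of `Fin N`. -/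
theorem card_strictMono_le (u N : ℕ) :
    ((Finset.univ : Finset (Fin u → Fin N)).filter fun s => StrictMono s).card ≤ 2 ^ N := by
  classical
  have : (2 : ℕ) ^ N = (Finset.univ : Finset (Finset (Fin N))).card := by
    simp [Finset.card_univ]
  rw [this]
  refine Finset.card_le_card_of_injOn (fun s => Finset.univ.image s) (by simp) ?_
  intro s hs s' hs' h
  simp only [Finset.coe_filter, Finset.mem_univ, true_and, Set.mem_ofPred_eq] at hs hs'
  refine (StrictMono.range_inj hs hs').1 ?_
  have := congrArg (fun A : Finset (Fin N) => (A : Set (Fin N))) h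
  simpa using this

/-- The bound log n ≤ N n^(1/N), raised to the power `N`. It absorbs the polylogarithmic factors
into a single factor `n`. -/
theorem exists_logb_pow_le (K : ℝ) (hK : 0 < K) (N : ℕ) (hN : 0 < N) :
    ∃ C : ℝ, 0 < C ∧ ∀ n : ℕ, 0 < n → (K * Real.logb 2 n) ^ N ≤ C * n := by
  have hl : 0 < Real.log 2 := Real.log_pos one_lt_two
  have hN' : (0 : ℝ) < N := by exact_mod_cast hN
  refine ⟨(K * N / Real.log 2) ^ N, by positivity, fun n hn => ?_⟩
  have h1 : Real.log n ≤ (n : ℝ) ^ (1 / (N : ℝ)) / (1 / (N : ℝ)) :=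
    Real.log_le_rpow_div (Nat.cast_nonneg n) (by positivity)
  have h0 : 0 ≤ Real.log n := Real.log_natCast_nonneg n
  have h2 : K * Real.logb 2 n ≤ K * N / Real.log 2 * (n : ℝ) ^ (1 / (N : ℝ)) := by
    rw [Real.logb]
    calc K * (Real.log n / Real.log 2)
        ≤ K * (((n : ℝ) ^ (1 / (N : ℝ)) / (1 / (N : ℝ))) / Real.log 2) := by gcongr
      _ = _ := by field_simp
  calc (K * Real.logb 2 n) ^ N ≤ (K * N / Real.log 2 * (n : ℝ) ^ (1 / (N : ℝ))) ^ N :=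
        pow_le_pow_left₀ (by rw [Real.logb]; positivity) h2 N
    _ = _ := by
        rw [mul_pow, ← Real.rpow_natCast ((n : ℝ) ^ (1 / (N : ℝ))) N,
          ← Real.rpow_mul (Nat.cast_nonneg n), one_div_mul_cancel hN'.ne', Real.rpow_one]

/-- The failure term of small connected hypergraphs, bounded by the expected number of trees of
collisions on critical key sets. -/
theorem failureTerm_smallConnected_le_sum {U : Type*} [LinearOrder U] {c d ℓ n : ℕ} (K : ℝ)
    (hc : 1 ≤ c) (hd : 0 < d) (hn : 0 < n) (hdn : d ∣ n)
    {F : Finset (U → Fin ℓ)} (hF : IsUniversal 2 F)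
    {H : Finset (U → Fin (n / d))} (hH : IsWiseIndependent 2 H) (S : Finset U) (hS : S.card = n) :
    failureTerm c F H S hS (smallConnected K d n) ≤
      ∑ u ∈ Finset.range ⌊K * Real.logb 2 n⌋₊, (n : ℝ) ^ (u + 1) * 2 ^ (d * u) *
        ((((u : ℝ) + 1) ^ 2 / ℓ) ^ c * (1 / ((n / d : ℕ) : ℝ)) ^ u) := by
  classical
  have hm : 0 < n / d := Nat.div_pos (Nat.le_of_dvd hn hdn) hd
  have : NeZero (n / d) := ⟨hm.ne'⟩
  set X := S.orderEmbOfFin hS with hX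
  let P (u : ℕ) (q : (Fin (u + 1) → Fin n) × (Fin u → Fin (d * u))) (ω : HashSeq U c d ℓ (n / d)) :
      Prop :=
    Function.Injective q.1 ∧ StrictMono q.2 ∧ (∀ k, (q.2 k : ℕ) / d ≤ k) ∧
        deficiency ω (Finset.univ.image fun k => X (q.1 k)) = 1 ∧
        ∀ k, ∀ p : Fin (u + 1), (p : ℕ) = q.2 k / d →
          ω.eval ⟨q.2 k % d, Nat.mod_lt _ hd⟩ (X (q.1 k.succ)) =
          ω.eval ⟨q.2 k % d, Nat.mod_lt _ hd⟩ (X (q.1 p))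
  -- Only monotonicity enters the index set, since it alone gives the factor 2^(du); the other side
  -- conditions stay in `P` and are violated with probability zero contribution.
  let I (u : ℕ) : Finset ((Fin (u + 1) → Fin n) × (Fin u → Fin (d * u))) :=
    Finset.univ ×ˢ Finset.univ.filter fun s => StrictMono s
  have hI (u : ℕ) : ((I u).card : ℝ) ≤ (n : ℝ) ^ (u + 1) * 2 ^ (d * u) := by
    have h1 := card_strictMono_le u (d * u)
    simp only [I, Finset.card_product, Finset.card_univ, Fintype.card_fun, Fintype.card_fin]
    push_cast
    gcongr
    exact_mod_cast h1
  have hP (u : ℕ) (q) : uniformProb (hashClassZ c d F H) (P u q) ≤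
      (((u : ℝ) + 1) ^ 2 / ℓ) ^ c * (1 / ((n / d : ℕ) : ℝ)) ^ u := by
    by_cases hq : Function.Injective q.1 ∧ ∀ k, (q.2 k : ℕ) / d ≤ k
    · have hlt (k : Fin u) : (q.2 k : ℕ) / d < u + 1 := by
        have := hq.2 k
        omega
      refine le_trans (uniformProb_mono ?_) (uniformProb_tree_collision_le hc hF hH
        (x := fun k => X (q.1 k)) (X.injective.comp hq.1) (fun k => ⟨(q.2 k : ℕ) / d, hlt k⟩) ?_
        (fun k => ⟨q.2 k % d, Nat.mod_lt _ hd⟩) (Finset.univ.image fun k => X (q.1 k)) (by simp))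
      · rintro ω - ⟨-, -, -, h1, h2⟩
        exact ⟨h1, fun k => h2 k _ rfl⟩
      · intro k
        rw [Fin.lt_def]
        exact Nat.lt_succ_of_le (hq.2 k)
    · have : uniformProb (hashClassZ c d F H) (P u q) = 0 :=
        uniformProb_eq_zero fun ω _ h => hq ⟨h.1, h.2.2.1⟩
      rw [this]
      positivity
  calc failureTerm c F H S hS (smallConnected K d n)
      ≤ uniformProb (hashClassZ c d F H) (fun ω => ∃ u ∈ Finset.range ⌊K * Real.logb 2 n⌋₊,
          ∃ q ∈ I u, P u q ω) := by
        refine uniformProb_mono fun ω _ hω => ?_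
        obtain ⟨u, hu, q, hq⟩ := hω.exists_tree_collision hd
        refine ⟨u, hu, q, ?_, hq⟩
        simp only [I, Finset.mem_product, Finset.mem_univ, true_and, Finset.mem_filter]
        exact hq.2.1
    _ ≤ ∑ u ∈ Finset.range ⌊K * Real.logb 2 n⌋₊,
          uniformProb (hashClassZ c d F H) (fun ω => ∃ q ∈ I u, P u q ω) :=
        uniformProb_exists_le _ _ _
    _ ≤ ∑ u ∈ Finset.range ⌊K * Real.logb 2 n⌋₊, ∑ q ∈ I u,
          uniformProb (hashClassZ c d F H) (P u q) :=
        Finset.sum_le_sum fun u _ => uniformProb_exists_le _ _ _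
    _ ≤ ∑ u ∈ Finset.range ⌊K * Real.logb 2 n⌋₊, ∑ _q ∈ I u,
          ((((u : ℝ) + 1) ^ 2 / ℓ) ^ c * (1 / ((n / d : ℕ) : ℝ)) ^ u) :=
        Finset.sum_le_sum fun u _ => Finset.sum_le_sum fun q _ => hP u q
    _ ≤ _ := by
        refine Finset.sum_le_sum fun u _ => ?_
        rw [Finset.sum_const, nsmul_eq_mul]
        exact mul_le_mul_of_nonneg_right (hI u) (by positivity)

theorem exists_failureTerm_smallConnected_le (K : ℝ) (hK : 0 < K) (c d : ℕ) (hc : 1 ≤ c)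
    (hd : 2 ≤ d) :
    ∃ C : ℝ, 0 < C ∧ ∀ (n ℓ : ℕ), 0 < n → d ∣ n →
      ∀ (U : Type u) [LinearOrder U] (F : Finset (U → Fin ℓ)) (H : Finset (U → Fin (n / d))),
        IsUniversal 2 F → IsWiseIndependent 2 H → ∀ (S : Finset U) (hS : S.card = n),
        failureTerm c F H S hS (smallConnected K d n) ≤
          C * ((n : ℝ) ^ (K * ((d : ℝ) + 1) * Real.logb 2 d + 2) / (ℓ : ℝ) ^ c) := by
  -- The exponent collects `2 * c` from the collisions of the `g_j` and one from the number of
  -- values of `u`.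
  obtain ⟨C, hC, hCn⟩ := exists_logb_pow_le K hK (2 * c + 1) (Nat.succ_pos _)
  refine ⟨C, hC, fun n ℓ hn hdn U _ F H hF hH S hS => ?_⟩
  refine (failureTerm_smallConnected_le_sum K hc (by omega) hn hdn hF hH S hS).trans ?_
  set L := K * Real.logb 2 n with hL
  have hd0 : (0 : ℝ) < d := by exact_mod_cast (by omega : 0 < d)
  have hd1 : (1 : ℝ) ≤ d := by exact_mod_cast (by omega : 1 ≤ d)
  have hn0 : (0 : ℝ) < n := by exact_mod_cast hn
  have hn1 : (1 : ℝ) ≤ n := by exact_mod_cast hn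
  have hL0 : 0 ≤ L := mul_nonneg hK.le (Real.logb_nonneg one_lt_two hn1)
  have hN : (⌊L⌋₊ : ℝ) ≤ L := Nat.floor_le hL0
  set e := K * ((d : ℝ) + 1) * Real.logb 2 d with he
  have hpow (u : ℕ) (hu : u < ⌊L⌋₊) : ((2 : ℝ) ^ d * d) ^ u ≤ (n : ℝ) ^ e := by
    have huL : (u : ℝ) ≤ L := le_trans (by exact_mod_cast hu.le) hN
    -- Bounding 2 by `d` merges the 2^d shapes and the factor `d` from 1/m = d/n into d^(d+1); then
    -- d^(log n) = n^(log d).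
    calc ((2 : ℝ) ^ d * d) ^ u ≤ ((d : ℝ) ^ d * d) ^ u := by
          gcongr
          exact_mod_cast hd
      _ = (d : ℝ) ^ (((d : ℝ) + 1) * u) := by
          rw [← pow_succ, ← pow_mul, ← Real.rpow_natCast]
          push_cast
          rfl
      _ ≤ (d : ℝ) ^ (((d : ℝ) + 1) * L) := by
          refine Real.rpow_le_rpow_of_exponent_le hd1 ?_
          gcongr
      _ = (n : ℝ) ^ e := by
          rw [Real.rpow_def_of_pos hd0, Real.rpow_def_of_pos hn0, he, hL, Real.logb, Real.logb]
          congr 1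
          ring
  have hterm : ∀ u ∈ Finset.range ⌊L⌋₊, (n : ℝ) ^ (u + 1) * 2 ^ (d * u) *
        ((((u : ℝ) + 1) ^ 2 / ℓ) ^ c * (1 / ((n / d : ℕ) : ℝ)) ^ u) ≤
      n * (n : ℝ) ^ e * (L ^ (2 * c) / (ℓ : ℝ) ^ c) := by
    intro u hu
    rw [Finset.mem_range] at hu
    have hu1 : (u : ℝ) + 1 ≤ L := le_trans (by exact_mod_cast hu) hN
    have hE : (n : ℝ) ^ (u + 1) * 2 ^ (d * u) *
        ((((u : ℝ) + 1) ^ 2 / ℓ) ^ c * (1 / ((n / d : ℕ) : ℝ)) ^ u) =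
        n * ((2 : ℝ) ^ d * d) ^ u * (((u : ℝ) + 1) ^ (2 * c) / (ℓ : ℝ) ^ c) := by
      rw [Nat.cast_div hdn hd0.ne', one_div_div, div_pow, div_pow, ← pow_mul, mul_pow, ← pow_mul,
        pow_succ]
      field_simp
    rw [hE]
    have := hpow u hu
    gcongr
  calc _ ≤ ∑ _u ∈ Finset.range ⌊L⌋₊, n * (n : ℝ) ^ e * (L ^ (2 * c) / (ℓ : ℝ) ^ c) :=
        Finset.sum_le_sum hterm
    _ = ⌊L⌋₊ * (n * (n : ℝ) ^ e * (L ^ (2 * c) / (ℓ : ℝ) ^ c)) := by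
        rw [Finset.sum_const, Finset.card_range, nsmul_eq_mul]
    _ ≤ L * (n * (n : ℝ) ^ e * (L ^ (2 * c) / (ℓ : ℝ) ^ c)) := by gcongr
    _ = L ^ (2 * c + 1) * (n * (n : ℝ) ^ e / (ℓ : ℝ) ^ c) := by ring
    _ ≤ (C * n) * (n * (n : ℝ) ^ e / (ℓ : ℝ) ^ c) := by
        have := hCn n hn
        gcongr
    _ = C * ((n : ℝ) ^ (e + 2) / (ℓ : ℝ) ^ c) := by
        rw [Real.rpow_add hn0, Real.rpow_two]
        ring

/-! ### The size of multicycles. -/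

/-- In a rooted tree, every vertex other than the root has a neighbour closer to the root. -/
theorem exists_adj_dist_add_one {W : Type*} {T : SimpleGraph W} (hT : T.Connected) {s v : W}
    (hv : v ≠ s) : ∃ y, T.Adj v y ∧ T.dist s y + 1 = T.dist s v := by
  obtain ⟨p, hp⟩ := (hT v s).exists_walk_length_eq_dist
  cases p with
  | nil => exact absurd rfl hv
  | @cons _ y _ h q =>
    refine ⟨y, h, ?_⟩
    have h1 := SimpleGraph.dist_le q
    have h2 := hT.dist_triangle (u := s) (v := y) (w := v)
    have h3 : T.dist y v = 1 := SimpleGraph.dist_eq_one_iff_adj.2 h.symm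
    rw [SimpleGraph.Walk.length_cons] at hp
    rw [SimpleGraph.dist_comm (u := y)] at h1
    rw [SimpleGraph.dist_comm (u := v)] at hp
    omega

/-- A multicycle has at most `2kt + 1` vertices. -/
theorem IsMulticycle.card_le {W : Type*} [Finite W] {B : SimpleGraph W} {k t : ℕ}
    (h : IsMulticycle B k t) : Nat.card W ≤ 2 * k * t + 1 := by
  classical
  have := Fintype.ofFinite W
  obtain ⟨-, hcyc, s, T, hTB, hT, -, hdepth, hleaf⟩ := h
  have hpar : ∀ v, ∃ y, v ≠ s → T.Adj v y ∧ T.dist s y + 1 = T.dist s v := by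
    intro v
    by_cases hv : v = s
    · exact ⟨v, fun h => absurd hv h⟩
    · obtain ⟨y, hy⟩ := exists_adj_dist_add_one hT.1 hv
      exact ⟨y, fun _ => hy⟩
  choose par hpar using hpar
  have hTcard : T.edgeSet.ncard + 1 = Nat.card W := by
    rw [Nat.card_eq_fintype_card, ← hT.card_edgeFinset, Set.ncard_eq_toFinset_card']
    rfl
  -- every edge of the tree joins a vertex to its parent
  have hedges : (fun v => s(v, par v)) '' {v | v ≠ s} = T.edgeSet := by
    refine Set.eq_of_subset_of_ncard_le ?_ ?_ (Set.toFinite _)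
    · rintro _ ⟨v, hv, rfl⟩
      exact (hpar v hv).1
    · rw [Set.InjOn.ncard_image]
      · have h1 : ({v | v ≠ s} : Set W) = {s}ᶜ := by ext; simp
        have h2 := Set.ncard_add_ncard_compl ({s} : Set W)
        rw [Set.ncard_singleton, ← h1] at h2
        omega
      · intro v hv w hw hvw
        simp only [Sym2.eq_iff] at hvw
        rcases hvw with h | ⟨h1, h2⟩
        · exact h.1
        · have e1 := (hpar v hv).2
          have e2 := (hpar w hw).2
          rw [h2] at e1
          rw [← h1] at e2
          omega
  set L : Set W := {v | v ≠ s ∧ (T.neighborSet v).ncard = 1} with hL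
  have hchild : ∀ v, v ≠ s → v ∉ L → ∃ y, y ≠ s ∧ par y = v := by
    intro v hv hvL
    by_contra! hno
    refine hvL ⟨hv, ?_⟩
    rw [Set.ncard_eq_one]
    refine ⟨par v, Set.eq_singleton_iff_unique_mem.2 ⟨(hpar v hv).1, fun y hy => ?_⟩⟩
    have hy' : s(v, y) ∈ T.edgeSet := hy
    rw [← hedges] at hy'
    obtain ⟨w, hw, hwy⟩ := hy'
    simp only [Sym2.eq_iff] at hwy
    rcases hwy with ⟨rfl, h⟩ | ⟨h1, h2⟩
    · exact h.symm
    · exact absurd h2 (hno w hw)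
  -- Every non-root vertex is an ancestor of a leaf (or a leaf itself). `N` is fuel: passing to a
  -- child raises the depth, which is at most `t`.
  have hdesc : ∀ N v, v ≠ s → t ≤ T.dist s v + N →
      ∃ w ∈ L, ∃ i, par^[i] w = v ∧ T.dist s w = T.dist s v + i := by
    intro N
    induction N with
    | zero =>
      intro v hv hN
      by_cases hvL : v ∈ L
      · exact ⟨v, hvL, 0, rfl, rfl⟩
      · obtain ⟨y, hy, rfl⟩ := hchild v hv hvL
        have := (hpar y hy).2
        have := hdepth y
        omega
    | succ N ih =>
      intro v hv hN
      by_cases hvL : v ∈ L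
      · exact ⟨v, hvL, 0, rfl, rfl⟩
      · obtain ⟨y, hy, rfl⟩ := hchild v hv hvL
        have h1 := (hpar y hy).2
        obtain ⟨w, hw, i, hi, hwi⟩ := ih y hy (by omega)
        refine ⟨w, hw, i + 1, ?_, by omega⟩
        rw [Function.iterate_succ_apply', hi]
  -- The cyclomatic number counts the non-tree edges, and each of these has only two endpoints to
  -- serve leaves.
  have hLcard : L.ncard ≤ 2 * k := by
    have hsub : T.edgeSet ⊆ B.edgeSet := SimpleGraph.edgeSet_mono hTB
    have hdiff : (B.edgeSet \ T.edgeSet).ncard = k := by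
      have := Set.ncard_sdiff_add_ncard_of_subset hsub (Set.toFinite _)
      omega
    have hLsub : L.toFinset ⊆ (B.edgeSet \ T.edgeSet).toFinset.biUnion fun e => e.toFinset := by
      intro v hv
      rw [Set.mem_toFinset] at hv
      obtain ⟨w, hw, hw'⟩ := hleaf v hv.1 hv.2
      refine Finset.mem_biUnion.2 ⟨s(v, w), ?_, by simp⟩
      rw [Set.mem_toFinset]
      exact ⟨hw, hw'⟩
    have h1 := (Finset.card_le_card hLsub).trans
      (Finset.card_biUnion_le_card_mul _ _ 2 fun e _ => ?_)
    · rw [← Set.ncard_eq_toFinset_card', ← Set.ncard_eq_toFinset_card', hdiff] at h1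
      omega
    · induction e using Sym2.ind with
      | _ a b =>
        rw [Sym2.toFinset_mk_eq]
        exact Finset.card_le_two
  -- A non-root ancestor has depth at least one, so it lies fewer than `t` steps above its leaf:
  -- each leaf accounts for at most `t` vertices, and the root adds one.
  have hcover : (Finset.univ : Finset W) ⊆
      insert s ((L.toFinset ×ˢ Finset.range t).image fun q => par^[q.2] q.1) := by
    intro v _
    rw [Finset.mem_insert]
    by_cases hv : v = s
    · exact Or.inl hv
    · right
      obtain ⟨w, hw, i, hi, hwi⟩ := hdesc t v hv (by omega)
      refine Finset.mem_image.2 ⟨(w, i), ?_, hi⟩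
      rw [Finset.mem_product, Set.mem_toFinset, Finset.mem_range]
      refine ⟨hw, ?_⟩
      have h1 := hdepth w
      have h2 := (hpar v hv).2
      omega
  have h1 := (Finset.card_le_card hcover).trans (Finset.card_insert_le _ _)
  have h2 : ((L.toFinset ×ˢ Finset.range t).image fun q => par^[q.2] q.1).card ≤ 2 * k * t := by
    refine Finset.card_image_le.trans ?_
    rw [Finset.card_product, Finset.card_range, ← Set.ncard_eq_toFinset_card']
    exact Nat.mul_le_mul_right _ hLcard
  rw [Nat.card_eq_fintype_card, ← Finset.card_univ]
  omega

/-! ### Multicycles and witness trees as small connected hypergraphs. -/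

namespace LabeledHypergraph

variable {d m n : ℕ}

theorem mem_labels {G : LabeledHypergraph d m n} {i : Fin n} :
    i ∈ G.labels ↔ (G.edge i).Nonempty := by
  simp [labels]

theorem joined_symm {G : LabeledHypergraph d m n} : Std.Symm G.Joined :=
  ⟨fun _ _ ⟨i, h1, h2⟩ => ⟨i, h2, h1⟩⟩

theorem numEdges_le_card_support (G : LabeledHypergraph d m n) :
    G.numEdges ≤ Nat.card G.bi.support := by
  classical
  have h : ∀ i : G.labels, (Sum.inl i.1 : Fin n ⊕ (Fin d × Fin m)) ∈ G.bi.support := by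
    rintro ⟨i, hi⟩
    obtain ⟨v, hv⟩ := mem_labels.1 hi
    exact (SimpleGraph.mem_support _).2 ⟨Sum.inr v, hv⟩
  have := Nat.card_le_card_of_injective
    (fun i : G.labels => (⟨Sum.inl i.1, h i⟩ : G.bi.support)) (by
      intro i j hij
      exact Subtype.ext (Sum.inl.inj (Subtype.ext_iff.1 hij)))
  simpa [numEdges] using this

theorem isConnected_of_bi (G : LabeledHypergraph d m n)
    (h : (G.bi.induce G.bi.support).Connected) : G.IsConnected := by
  rintro u v ⟨i, hi⟩ ⟨j, hj⟩
  have hu : (Sum.inr u : Fin n ⊕ (Fin d × Fin m)) ∈ G.bi.support :=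
    (SimpleGraph.mem_support _).2 ⟨Sum.inl i, hi⟩
  have hv : (Sum.inr v : Fin n ⊕ (Fin d × Fin m)) ∈ G.bi.support :=
    (SimpleGraph.mem_support _).2 ⟨Sum.inl j, hj⟩
  have hreach := (h ⟨_, hu⟩ ⟨_, hv⟩).map (SimpleGraph.Embedding.induce G.bi.support).toHom
  -- Paths alternate between machines and jobs, so the induction also carries a claim for job
  -- endpoints: all their machines are reachable.
  have key : ∀ b, Relation.ReflTransGen G.bi.Adj (Sum.inr u) b →
      (∀ v, b = Sum.inr v → Relation.ReflTransGen G.Joined u v) ∧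
      (∀ i, b = Sum.inl i → ∀ v ∈ G.edge i, Relation.ReflTransGen G.Joined u v) := by
    intro b hb
    induction hb with
    | refl => exact ⟨fun v hv => Sum.inr.inj hv ▸ .refl, fun i hi => nomatch hi⟩
    | @tail b c _ hstep ih =>
      rcases b with i | w <;> rcases c with i' | w'
      · exact hstep.elim
      · refine ⟨fun v hv => ?_, fun i hi => nomatch hi⟩
        cases hv
        exact ih.2 i rfl w' hstep
      · refine ⟨fun v hv => (nomatch hv), fun i hi v hv => ?_⟩
        cases hi
        exact (ih.1 w rfl).tail ⟨i', hstep, hv⟩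
      · exact hstep.elim
  exact (key _ ((SimpleGraph.reachable_iff_reflTransGen _ _).1 hreach)).1 v rfl

end LabeledHypergraph

theorem IsWitnessTree.isConnected {d m n τ r : ℕ} {G : LabeledHypergraph d m n}
    (h : IsWitnessTree τ r G) : G.IsConnected := by
  obtain ⟨machine, job, -, -, hlab, hedge⟩ := h
  have hroot : ∀ p : List (Fin τ × Fin (d - 1)), p.length ≤ r →
      Relation.ReflTransGen G.Joined (machine []) (machine p) := by
    intro p
    induction p using List.reverseRecOn with
    | nil => intro _; exact .refl
    | append_singleton p a ih =>
      intro hp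
      rw [List.length_append, List.length_singleton] at hp
      refine (ih (by omega)).tail ⟨job (p, a.1), ?_, ?_⟩
      · rw [hedge p a.1 (by omega)]
        exact Finset.mem_insert_self _ _
      · rw [hedge p a.1 (by omega)]
        exact Finset.mem_insert_of_mem (Finset.mem_image.2 ⟨a.2, Finset.mem_univ _, rfl⟩)
  have hall : ∀ u, (∃ i, u ∈ G.edge i) → Relation.ReflTransGen G.Joined (machine []) u := by
    rintro u ⟨i, hu⟩
    obtain ⟨⟨p, a⟩, hp, rfl⟩ := (hlab i).1 (LabeledHypergraph.mem_labels.2 ⟨u, hu⟩)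
    rw [hedge p a hp, Finset.mem_insert, Finset.mem_image] at hu
    rcases hu with rfl | ⟨b, -, rfl⟩
    · exact hroot p (le_of_lt hp)
    · exact hroot _ (by simpa using hp)
  have := LabeledHypergraph.joined_symm (G := G)
  exact fun u v hu hv => (symm (hall u hu)).trans (hall v hv)

theorem IsWitnessTree.numEdges_le {d m n τ r : ℕ} {G : LabeledHypergraph d m n}
    (h : IsWitnessTree τ r G) : G.numEdges ≤ witnessTreeJobs d τ r := by
  classical
  obtain ⟨machine, job, -, -, hlab, -⟩ := h
  -- Jobs are counted by level: an address of length `i` is a function on `Fin i`, which makes each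
  -- level finite with τ(τ(d-1))^i jobs.
  have hsub : G.labels ⊆ (Finset.range r).biUnion fun i =>
      (Finset.univ : Finset ((Fin i → Fin τ × Fin (d - 1)) × Fin τ)).image
        fun q => job (List.ofFn q.1, q.2) := by
    intro i hi
    obtain ⟨⟨p, a⟩, hp, rfl⟩ := (hlab i).1 hi
    refine Finset.mem_biUnion.2 ⟨p.length, Finset.mem_range.2 hp, ?_⟩
    exact Finset.mem_image.2 ⟨(p.get, a), Finset.mem_univ _, by simp⟩
  refine (Finset.card_le_card hsub).trans (Finset.card_biUnion_le.trans ?_)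
  refine Finset.sum_le_sum fun i _ => Finset.card_image_le.trans (le_of_eq ?_)
  simp [Finset.card_univ, mul_comm]

theorem multicycleOrWitnessTree_subset_smallConnected {K : ℝ} {d n τ k t r : ℕ}
    (hk : 2 * (k : ℝ) * t + 1 ≤ K * Real.logb 2 n)
    (hr : (witnessTreeJobs d τ r : ℝ) ≤ K * Real.logb 2 n) :
    multicycleOrWitnessTree d n τ k t r ⊆ smallConnected K d n := by
  rintro G ⟨hG, hmc | hwt⟩
  · refine ⟨hG, G.isConnected_of_bi hmc.1, le_trans ?_ hk⟩
    exact_mod_cast G.numEdges_le_card_support.trans hmc.card_le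
  · exact ⟨hG, hwt.isConnected, le_trans (by exact_mod_cast hwt.numEdges_le) hr⟩

theorem failureTerm_mono {U : Type*} [LinearOrder U] (c : ℕ) {d ℓ m n : ℕ}
    (F : Finset (U → Fin ℓ)) (H : Finset (U → Fin m)) (S : Finset U) (hS : S.card = n)
    {A A' : Set (LabeledHypergraph d m n)} (h : A ⊆ A') :
    failureTerm c F H S hS A ≤ failureTerm c F H S hS A' :=
  uniformProb_mono fun _ _ ⟨G, hG, hG'⟩ => ⟨G, h hG, hG'⟩

end HashGraph

theorem mainTheorem12 (K : ℝ) (hK : 0 < K) (c d : ℕ) (hc : 1 ≤ c) (hd : 2 ≤ d) :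
    ∃ C : ℝ, 0 < C ∧
      ∀ (n ℓ : ℕ), 0 < n → d ∣ n → 1 ≤ ℓ →
      ∀ (U : Type u) [Fintype U] [LinearOrder U]
        (F : Finset (U → Fin ℓ)) (H : Finset (U → Fin (n / d))),
        HashGraph.IsUniversal 2 F → HashGraph.IsWiseIndependent 2 H →
      ∀ (S : Finset U) (hS : S.card = n),
        HashGraph.failureTerm c F H S hS (HashGraph.smallConnected K d n) ≤
            C * ((n : ℝ) ^ (K * ((d : ℝ) + 1) * Real.logb 2 d + 2) / (ℓ : ℝ) ^ c) ∧
        ∀ (τ k t r : ℕ), 1 ≤ k → 1 ≤ t →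
          (2 * (k : ℝ) * t + 1) ≤ K * Real.logb 2 n →
          (HashGraph.witnessTreeJobs d τ r : ℝ) ≤ K * Real.logb 2 n →
          HashGraph.failureTerm c F H S hS (HashGraph.multicycleOrWitnessTree d n τ k t r) ≤
            HashGraph.failureTerm c F H S hS (HashGraph.smallConnected K d n) := by
  obtain ⟨C, hC, hbound⟩ := HashGraph.exists_failureTerm_smallConnected_le.{u} K hK c d hc hd
  refine ⟨C, hC, fun n ℓ hn hdn _ U _ _ F H hF hH S hS =>
    ⟨hbound n ℓ hn hdn U F H hF hH S hS, fun τ k t r _ _ hkt hr => ?_⟩⟩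
  exact HashGraph.failureTerm_mono c F H S hS
    (HashGraph.multicycleOrWitnessTree_subset_smallConnected hkt hr)
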